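/- Setting. Let $X=\mathbb R^d$ with the Euclidean distance, $B(x,r)=\{y:|x-y|<r\}$, and let $\lambda$ be Lebesgue measure. Let $\mathcal W$ be a convex cone of lower semicontinuous functions $X\to[0,\infty]$ with $1\in\mathcal W$ such that $(X,\mathcal W)$ is a balayage space. That is: $\mathcal W$ separates points; each $w\in\mathcal W$ is the supremum of its minorants in $\mathcal W\cap C(X)$ ($C(X)$ being the continuous real functions); there are strictly positive $u,v\in\mathcal W\cap C(X)$ with $u/v\to0$ at infinity; $\mathcal W$ is closed under limits of increasing sequences; for every $\mathcal V\subset\mathcal W$ the greatest finely lower semicontinuous minorant of $\inf\mathcal V$ belongs to $\mathcal W$ (the fine topology being the coarsest topology finer than the Euclidean one that makes all $w\in\mathcal W$ continuous); and if $u,v',v''\in\mathcal W$ and $u\le v'+v''$, then $u=u'+u''$ with $u',u''\in\mathcal W$, $u'\le v'$, $u''\le v''$. For $u\in\mathcal W$, $A\subset X$ and $x\in X$ let $R_u^A=\inf\{v\in\mathcal W: v\ge u\text{ on }A\}$, and let $\varepsilon_x^A$ be the reduced measure, that is, the measure with $\int u\,d\varepsilon_x^A=R_u^A(x)$ for all $u\in\mathcal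 W$. A Borel function $h\ge0$ is harmonic on an open set $U$ if $h|_U$ is continuous and real and $\int h\,d\varepsilon_x^{V^c}=h(x)$ for every open $V$ with compact closure contained in $U$ and every $x\in V$. A potential is a function $p\in\mathcal W$ such that, for all relatively compact open $V$, $R_p^{V^c}$ is continuous and real on $V$, and the infimum of these functions $R_p^{V^c}$ is $0$. Assume that there are a Borel function $G:X\times X\to(0,\infty]$, a decreasing function $g:[0,\infty)\to(0,\infty]$ and $0<R_0\le\infty$ such that: 1. $G=\infty$ on the diagonal; for every $y$, $G(\cdot,y)$ is a potential which is harmonic on $X\setminus\{y\}$; every potential is of the form $\int G(\cdot,y)\,d\mu(y)$ for some measure $\mu$. 2. For some $c\ge1$, $c_D>1$ and $\alpha_0,\eta_0\in(0,1)$: $c^{-1}g(|x-y|)\le G(x,y)\le c\,g(|x-y|)$ for all $x,y\in X$, and $g(r/2)\le c_Dg(r)$, $g(r)\le\eta_0g(\alpha_0r)$ for $0<r<R_0$. 3. For some $C_G\ge1$: $\frac1{\lambda(B(x,r))}\int_{B(x,r)}G(w,y)\,d\lambda(y)\le C_G\,g(r)$ for all $x,w\in X$ and $0<r<R_0$. 4.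 There are a kernel $N$ on $X$, $M_N\ge3$ and $C_N\ge1$ such that, for all $x\in X$ and $0<r<R_0$, writing $B=B(x,r)$ and $G_B(\cdot,z)=G(\cdot,z)-R_{G(\cdot,z)}^{B^c}$ for $z\in B$, $$C_N^{-1}\varepsilon_x^{B^c}\le\int_BG_B(x,z)\,N(z,\cdot)\,d\lambda(z)\le C_N\,\varepsilon_x^{B^c}\quad\text{on }B(x,M_Nr)^c.$$ Statement. Suppose that there are a measure $\tilde\lambda$ on $\mathbb R^d$ and a Borel function $n:\mathbb R^d\times\mathbb R^d\to[0,\infty)$ such that $N(y,\cdot)=n(y,\cdot)\tilde\lambda$ for every $y\in X$. Suppose that, for some function $n_0\ge0$ and some $C\ge1$, $C^{-1}n_0(|x-y|)\le n(x,y)\le C\,n_0(|x-y|)$ for all $x\ne y$, and that there is $C_0\ge1$ with $$n_0(s)\le C_0\,n_0(r)\qquad\text{whenever }0<r<s<2r.$$ Then there exist $0<R_1\le\infty$, $c_J>0$ and $0<\alpha<1/2$ such that, for all $x\in X$, $0<r<R_1$ and $y\in B(x,\alpha r)$, $$\varepsilon_x^{B(x,\alpha r)^c}\le c_J\,\varepsilon_y^{B(y,r)^c}\quad\text{on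 }B(y,r)^c.$$ -/

import Mathlib

open Set Filter Topology MeasureTheory
open scoped NNReal ENNReal

namespace PotentialTheory

noncomputable section

/-! Positive numerical functions on `X` are functions `X → ℝ≥0∞`; measures are Borel measures. -/

section Topological

variable {X : Type*} [TopologicalSpace X]

/-- The functions of `W` that are continuous and real-valued. -/
def realContinuous (W : Set (X → ℝ≥0∞)) : Set (X → ℝ≥0∞) :=
  {w | w ∈ W ∧ Continuous w ∧ ∀ x, w x ≠ ∞}

/-- The fine topology: the coarsest topology on `X` that is finer than the given one and makes
all functions of `W` continuous. -/
abbrev fineTopology (W : Set (X → ℝ≥0∞)) : TopologicalSpace X :=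
  (inferInstance : TopologicalSpace X) ⊓
    ⨅ w ∈ W, TopologicalSpace.induced w (inferInstance : TopologicalSpace ℝ≥0∞)

/-- The greatest finely lower semicontinuous minorant of `f`. -/
def fineLscRegularization (W : Set (X → ℝ≥0∞)) (f : X → ℝ≥0∞) : X → ℝ≥0∞ :=
  sSup {h | h ≤ f ∧ @LowerSemicontinuous X ℝ≥0∞ (fineTopology W) _ h}

/-- `(X, W)` is a balayage space: `W` is a convex cone of positive lower semicontinuous numerical
functions on `X` which separates points, is generated by its continuous real members, has
strictly positive continuous real members `u`, `v` with `u / v → 0` at infinity, is closed under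
increasing limits and under finely l.s.c. regularized infima, and has the Riesz decomposition
property.  (The space `X` is meant to be locally compact with countable base.) -/
structure IsBalayageSpace (W : Set (X → ℝ≥0∞)) : Prop where
  add_mem : ∀ u ∈ W, ∀ v ∈ W, u + v ∈ W
  smul_mem : ∀ a : ℝ≥0, ∀ w ∈ W, (fun x => (a : ℝ≥0∞) * w x) ∈ W
  lsc : ∀ w ∈ W, LowerSemicontinuous w
  separates : ∀ x y : X, x ≠ y → ∃ w ∈ W, w x ≠ w y
  eq_sSup_continuous : ∀ w ∈ W, w = sSup {v | v ∈ realContinuous W ∧ v ≤ w}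
  exists_vanishing : ∃ u ∈ realContinuous W, ∃ v ∈ realContinuous W,
    (∀ x, 0 < u x) ∧ (∀ x, 0 < v x) ∧ Tendsto (fun x => u x / v x) (cocompact X) (𝓝 0)
  iSup_mem : ∀ w : ℕ → X → ℝ≥0∞, (∀ k, w k ∈ W) → Monotone w → (⨆ k, w k) ∈ W
  regularized_sInf_mem : ∀ V ⊆ W, fineLscRegularization W (sInf V) ∈ W
  riesz : ∀ u ∈ W, ∀ v₁ ∈ W, ∀ v₂ ∈ W, u ≤ v₁ + v₂ →
    ∃ u₁ ∈ W, ∃ u₂ ∈ W, u = u₁ + u₂ ∧ u₁ ≤ v₁ ∧ u₂ ≤ v₂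

/-- The reduced function `R_u^A = inf {v ∈ W : v ≥ u on A}`. -/
def reduced (W : Set (X → ℝ≥0∞)) (u : X → ℝ≥0∞) (A : Set X) : X → ℝ≥0∞ :=
  sInf {v | v ∈ W ∧ ∀ y ∈ A, u y ≤ v y}

/-- A potential: `p ∈ W` such that, for `V` open and relatively compact, `R_p^{Vᶜ}` is continuous
and real on `V`, and the infimum of these functions over all such `V` is zero. -/
structure IsPotential (W : Set (X → ℝ≥0∞)) (p : X → ℝ≥0∞) : Prop where
  mem : p ∈ W
  continuousOn : ∀ V : Set X, IsOpen V → IsCompact (closure V) →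
    ContinuousOn (reduced W p Vᶜ) V ∧ ∀ x ∈ V, reduced W p Vᶜ x ≠ ∞
  iInf_eq_zero : ∀ x, ⨅ V ∈ {V : Set X | IsOpen V ∧ IsCompact (closure V)},
    reduced W p Vᶜ x = 0

variable [MeasurableSpace X]

/-- The defining property of the reduced measure `ε_x^A`: `∫ u dε_x^A = R_u^A(x)` for all
`u ∈ W`. -/
def IsReducedMeasure (W : Set (X → ℝ≥0∞)) (x : X) (A : Set X) (μ : Measure X) : Prop :=
  ∀ u ∈ W, ∫⁻ z, u z ∂μ = reduced W u A x

open Classical in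
/-- The reduced measure `ε_x^A`.  For a balayage space it exists and is unique; the value `0` in
the other case is irrelevant. -/
def reducedMeasure (W : Set (X → ℝ≥0∞)) (x : X) (A : Set X) : Measure X :=
  if h : ∃ μ : Measure X, IsReducedMeasure W x A μ then h.choose else 0

/-- `h` is a positive Borel function on `X` which is harmonic on the open set `U`: it is
continuous and real on `U`, and `∫ h dε_x^{Vᶜ} = h x` for `x ∈ V`, `V` open with compact closure
contained in `U`. -/
structure IsHarmonicOn (W : Set (X → ℝ≥0∞)) (U : Set X) (h : X → ℝ≥0∞) : Prop where
  measurable : Measurable h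
  continuousOn : ContinuousOn h U
  ne_top : ∀ x ∈ U, h x ≠ ∞
  mean_value : ∀ V : Set X, IsOpen V → IsCompact (closure V) → closure V ⊆ U →
    ∀ x ∈ V, ∫⁻ z, h z ∂(reducedMeasure W x Vᶜ) = h x

/-- `G` is a Green function for `(X, W)`: a Borel function with values in `(0, ∞]`, infinite on
the diagonal, such that each `G(·, y)` is a potential harmonic off `y`, and each potential is of
the form `∫ G(·, y) dμ(y)`. -/
structure IsGreenFunction (W : Set (X → ℝ≥0∞)) (G : X → X → ℝ≥0∞) : Prop where
  measurable : Measurable (Function.uncurry G)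
  pos : ∀ x y, 0 < G x y
  diag : ∀ x, G x x = ∞
  isPotential : ∀ y, IsPotential W (fun x => G x y)
  isHarmonicOn : ∀ y, IsHarmonicOn W {y}ᶜ (fun x => G x y)
  representation : ∀ p, IsPotential W p → ∃ μ : Measure X, ∀ x, p x = ∫⁻ y, G x y ∂μ

/-- The Green function `G_V(x, y) = G(x, y) - R_{G(·, y)}^{Vᶜ}(x)` of an open set `V`, used for
`y ∈ V` only. -/
def greenOn (W : Set (X → ℝ≥0∞)) (G : X → X → ℝ≥0∞) (V : Set X) (x y : X) : ℝ≥0∞ :=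
  G x y - reduced W (fun w => G w y) Vᶜ x

end Topological

section Metric

variable {X : Type*} [MetricSpace X] [MeasurableSpace X]

/-- The main assumption on `(X, W)`, for the metric of `X`: `G` is a Green function, `g > 0` is a
decreasing numerical function on `[0, ∞)` with `G ≈ g ∘ ρ`, and `g` has the doubling property and
weak upper decay on `(0, R₀)`, where `0 < R₀ ≤ ∞`. -/
structure GreenAssumption (W : Set (X → ℝ≥0∞)) (G : X → X → ℝ≥0∞) (g : ℝ≥0 → ℝ≥0∞)
    (R₀ : ℝ≥0∞) : Prop where
  isGreenFunction : IsGreenFunction W G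
  g_antitone : Antitone g
  g_pos : ∀ r, 0 < g r
  R₀_pos : 0 < R₀
  comparable : ∃ c : ℝ≥0, 1 ≤ c ∧ ∀ x y : X,
    (c : ℝ≥0∞)⁻¹ * g (nndist x y) ≤ G x y ∧ G x y ≤ c * g (nndist x y)
  doubling : ∃ cD : ℝ≥0, 1 < cD ∧ ∀ r : ℝ≥0, 0 < r → (r : ℝ≥0∞) < R₀ → g (r / 2) ≤ cD * g r
  decay : ∃ α₀ η₀ : ℝ≥0, 0 < α₀ ∧ α₀ < 1 ∧ 0 < η₀ ∧ η₀ < 1 ∧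
    ∀ r : ℝ≥0, 0 < r → (r : ℝ≥0∞) < R₀ → g r ≤ η₀ * g (α₀ * r)

/-- The estimate of Ikeda-Watanabe type, for a measure `lam` and a kernel `N` on `X`: there are
`M ≥ 3` and `C ≥ 1` such that, for `x ∈ X` and `0 < r < R₀`, on the complement of `B(x, M r)`,
`C⁻¹ ε_x^{B(x,r)ᶜ} ≤ ∫ G_{B(x,r)}(x, z) N(z, ·) dlam(z) ≤ C ε_x^{B(x,r)ᶜ}`. -/
def IkedaWatanabeEstimate (W : Set (X → ℝ≥0∞)) (G : X → X → ℝ≥0∞) (R₀ : ℝ≥0∞)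
    (lam : Measure X) (N : ProbabilityTheory.Kernel X X) : Prop :=
  ∃ M C : ℝ≥0, 3 ≤ M ∧ 1 ≤ C ∧ ∀ (x : X) (r : ℝ≥0), 0 < r → (r : ℝ≥0∞) < R₀ →
    ∀ E : Set X, MeasurableSet E → E ⊆ (Metric.ball x (M * r))ᶜ →
      (C : ℝ≥0∞)⁻¹ * reducedMeasure W x (Metric.ball x r)ᶜ E
          ≤ ∫⁻ z in Metric.ball x r, greenOn W G (Metric.ball x r) x z * N z E ∂lam ∧
      ∫⁻ z in Metric.ball x r, greenOn W G (Metric.ball x r) x z * N z E ∂lam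
          ≤ C * reducedMeasure W x (Metric.ball x r)ᶜ E

/-- The assumption on the jumps: there are `0 < R₁ ≤ ∞`, `c_J > 0` and `0 < α < 1/2` such that,
for `x ∈ X`, `0 < r < R₁` and `y ∈ B(x, α r)`,
`ε_x^{B(x, α r)ᶜ} ≤ c_J ε_y^{B(y, r)ᶜ}` on `B(y, r)ᶜ`. -/
def JumpAssumption (W : Set (X → ℝ≥0∞)) : Prop :=
  ∃ (R₁ : ℝ≥0∞) (cJ α : ℝ≥0), 0 < R₁ ∧ 0 < cJ ∧ 0 < α ∧ α < 1 / 2 ∧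
    ∀ (x : X) (r : ℝ≥0), 0 < r → (r : ℝ≥0∞) < R₁ → ∀ y ∈ Metric.ball x (α * r),
      ∀ E : Set X, MeasurableSet E → E ⊆ (Metric.ball y r)ᶜ →
        reducedMeasure W x (Metric.ball x (α * r))ᶜ E
          ≤ cJ * reducedMeasure W y (Metric.ball y r)ᶜ E

end Metric

end

end PotentialTheory

/-! Let `a = α r` and let `F` be a part of `B(y, r)ᶜ`. The Ikeda-Watanabe estimate on `B(x, a)`,
with `G_B ≤ G` and the mean bound for `G`, gives `ε_x^{B(x, a)ᶜ}(F) ≲ λ(B(x, a)) g(a) sup N(z', F)`,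
the supremum being over `z' ∈ B(x, a)`. The same estimate on the larger ball `B(y, r / M)`,
restricted to a ball `B(q, a)` near `y`, gives `ε_y^{B(y, r / M)ᶜ}(F) ≳ λ(B(q, a)) g(8a) inf N(z,
F)`, because decay of `g` keeps the Green function of that ball above a multiple of `g(8a)` near `y`
(`le_greenOn_ball`). The two balls of radius `a` have equal volume, and `g(a) ≲ g(8a)` by doubling.

The kernels are compared by moving `q` from `y` towards `F`: all of `B(q, a)` is then closer to `F`
than `B(x, a)`, but by a factor less than 2, so the one-sided condition on `n₀` suffices
(`kernel_le_of_dist_lt`). Since `q` depends on the direction, `E` is cut into countably many pieces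
(`measure_le_mul_of_directions`).

Finally `ε_y^{B(y, r / M)ᶜ} ≤ ε_y^{B(y, r)ᶜ}` on `B(y, r)ᶜ` (`IsReducedMeasure.measure_le`), which
is proved from the lattice properties of `W`. -/

namespace PotentialTheory

/-! ### Differences of continuous members of `W`, and comparison of measures by them. -/

section Lattice

variable {X : Type*} [TopologicalSpace X] {W : Set (X → ℝ≥0∞)}

lemma IsBalayageSpace.inf_mem (hW : IsBalayageSpace W) {u v : X → ℝ≥0∞} (hu : u ∈ W)
    (hv : v ∈ W) : u ⊓ v ∈ W := by
  have hcont : ∀ w ∈ W, @Continuous X ℝ≥0∞ (fineTopology W) _ w := by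
    intro w hw
    rw [continuous_iff_le_induced]
    exact inf_le_right.trans (iInf₂_le w hw)
  have hlsc : @LowerSemicontinuous X ℝ≥0∞ (fineTopology W) _ (u ⊓ v) := by
    let := fineTopology W
    exact ((hcont u hu).inf (hcont v hv)).lowerSemicontinuous
  have h := hW.regularized_sInf_mem {u, v} (by
    rintro w (rfl | rfl)
    exacts [hu, hv])
  -- The minimum is finely continuous, hence its own regularization.
  have : fineLscRegularization W (sInf {u, v}) = u ⊓ v := by
    rw [sInf_pair]
    exact le_antisymm (sSup_le fun _ h => h.1) (le_sSup ⟨le_rfl, hlsc⟩)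
  rwa [this] at h

omit [TopologicalSpace X] in
lemma reduced_le_of_mem {u v : X → ℝ≥0∞} {A : Set X} (hv : v ∈ W) (h : ∀ y ∈ A, u y ≤ v y) :
    reduced W u A ≤ v :=
  sInf_le ⟨hv, h⟩

/-- The `ℝ≥0`-valued continuous members of `W`. -/
def continuousMembers (W : Set (X → ℝ≥0∞)) : Set (X → ℝ≥0) :=
  {f | Continuous f ∧ (fun x => (f x : ℝ≥0∞)) ∈ W}

/-- The differences of continuous real members of `W`. -/
def continuousDifferences (W : Set (X → ℝ≥0∞)) : Set (X → ℝ) :=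
  {f | ∃ u ∈ continuousMembers W, ∃ v ∈ continuousMembers W, ∀ x, f x = u x - v x}

lemma IsBalayageSpace.add_mem_continuousMembers (hW : IsBalayageSpace W) {u v : X → ℝ≥0}
    (hu : u ∈ continuousMembers W) (hv : v ∈ continuousMembers W) :
    u + v ∈ continuousMembers W := by
  refine ⟨hu.1.add hv.1, ?_⟩
  convert hW.add_mem _ hu.2 _ hv.2 using 1
  ext x
  simp

lemma IsBalayageSpace.smul_mem_continuousMembers (hW : IsBalayageSpace W) (a : ℝ≥0) {u : X → ℝ≥0}
    (hu : u ∈ continuousMembers W) : (fun x => a * u x) ∈ continuousMembers W := by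
  refine ⟨continuous_const.mul hu.1, ?_⟩
  convert hW.smul_mem a _ hu.2 using 1
  ext x
  simp

lemma IsBalayageSpace.inf_mem_continuousMembers (hW : IsBalayageSpace W) {u v : X → ℝ≥0}
    (hu : u ∈ continuousMembers W) (hv : v ∈ continuousMembers W) :
    u ⊓ v ∈ continuousMembers W := by
  refine ⟨hu.1.inf hv.1, ?_⟩
  convert hW.inf_mem hu.2 hv.2 using 1
  ext x
  simp

lemma IsBalayageSpace.const_mem (hW : IsBalayageSpace W) (h1 : (fun _ => 1) ∈ W) (a : ℝ≥0) :
    (fun _ : X => (a : ℝ≥0∞)) ∈ W := by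
  simpa using hW.smul_mem a _ h1

lemma IsBalayageSpace.const_mem_continuousMembers (hW : IsBalayageSpace W)
    (h1 : (fun _ => 1) ∈ W) (a : ℝ≥0) : (fun _ => a) ∈ continuousMembers W :=
  ⟨continuous_const, hW.const_mem h1 a⟩

lemma IsBalayageSpace.neg_mem_differences {f : X → ℝ} (hf : f ∈ continuousDifferences W) :
    -f ∈ continuousDifferences W := by
  obtain ⟨u, hu, v, hv, h⟩ := hf
  exact ⟨v, hv, u, hu, fun x => by simp [h]⟩

/-- `min (u - v) (u' - v') = min (u + v') (u' + v) - (v + v')`. -/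
lemma IsBalayageSpace.inf_mem_differences (hW : IsBalayageSpace W) {f f' : X → ℝ}
    (hf : f ∈ continuousDifferences W) (hf' : f' ∈ continuousDifferences W) :
    f ⊓ f' ∈ continuousDifferences W := by
  obtain ⟨u, hu, v, hv, h⟩ := hf
  obtain ⟨u', hu', v', hv', h'⟩ := hf'
  refine ⟨_, hW.inf_mem_continuousMembers (hW.add_mem_continuousMembers hu hv')
    (hW.add_mem_continuousMembers hu' hv), _, hW.add_mem_continuousMembers hv hv', fun x => ?_⟩
  simp only [Pi.inf_apply, Pi.add_apply, h, h', NNReal.coe_min, NNReal.coe_add, ← min_sub_sub_right]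
  congr 1 <;> ring

lemma IsBalayageSpace.sup_mem_differences (hW : IsBalayageSpace W) {f f' : X → ℝ}
    (hf : f ∈ continuousDifferences W) (hf' : f' ∈ continuousDifferences W) :
    f ⊔ f' ∈ continuousDifferences W := by
  have := neg_mem_differences
    (hW.inf_mem_differences (neg_mem_differences hf) (neg_mem_differences hf'))
  rwa [neg_inf, neg_neg, neg_neg] at this

lemma IsBalayageSpace.const_mem_differences (hW : IsBalayageSpace W) (h1 : (fun _ => 1) ∈ W)
    (a : ℝ≥0) : (fun _ => (a : ℝ)) ∈ continuousDifferences W :=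
  ⟨_, hW.const_mem_continuousMembers h1 a, _, hW.const_mem_continuousMembers h1 0, by simp⟩

lemma IsBalayageSpace.smul_mem_differences (hW : IsBalayageSpace W) (a : ℝ≥0) {f : X → ℝ}
    (hf : f ∈ continuousDifferences W) : (fun x => a * f x) ∈ continuousDifferences W := by
  obtain ⟨u, hu, v, hv, h⟩ := hf
  exact ⟨_, hW.smul_mem_continuousMembers a hu, _, hW.smul_mem_continuousMembers a hv,
    fun x => by simp [h, mul_sub]⟩

lemma continuous_of_mem_differences {f : X → ℝ} (hf : f ∈ continuousDifferences W) :
    Continuous f := by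
  obtain ⟨u, hu, v, hv, h⟩ := hf
  rw [funext h]
  exact (NNReal.continuous_coe.comp hu.1).sub (NNReal.continuous_coe.comp hv.1)

/-- Each member of `W` is a supremum of continuous real ones, so the latter already separate points.
-/
lemma IsBalayageSpace.exists_continuousMembers_ne (hW : IsBalayageSpace W) {x y : X}
    (hxy : x ≠ y) : ∃ f ∈ continuousMembers W, f x ≠ f y := by
  by_contra! h
  have h' : ∀ v ∈ realContinuous W, v x = v y := by
    intro v hv
    have hfin := hv.2.2
    have := h (fun z => (v z).toNNReal)
      ⟨by
        rw [continuous_iff_continuousAt]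
        exact fun z => (ENNReal.tendsto_toNNReal (hfin z)).comp hv.2.1.continuousAt,
       by simpa [ENNReal.coe_toNNReal (hfin _)] using hv.1⟩
    exact (ENNReal.toNNReal_eq_toNNReal_iff' (hfin x) (hfin y)).1 this
  obtain ⟨w, hw, hne⟩ := hW.separates x y hxy
  apply hne
  rw [hW.eq_sSup_continuous w hw]
  simp only [sSup_apply]
  exact iSup_congr fun v => h' _ v.2.1

/-- A continuous difference that is negative at `y` and positive at `x`. -/
lemma IsBalayageSpace.exists_difference_neg_pos (hW : IsBalayageSpace W) (h1 : (fun _ => 1) ∈ W)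
    {x y : X} (hxy : x ≠ y) : ∃ f ∈ continuousDifferences W, f y < 0 ∧ 0 < f x := by
  obtain ⟨f, hf, hne⟩ := hW.exists_continuousMembers_ne hxy
  rcases hne.lt_or_gt with h | h
  · obtain ⟨a, ha, ha'⟩ := exists_between h
    exact ⟨_, ⟨_, hW.const_mem_continuousMembers h1 a, f, hf, fun _ => rfl⟩,
      by simpa using ha', by simpa using ha⟩
  · obtain ⟨a, ha, ha'⟩ := exists_between h
    exact ⟨_, ⟨f, hf, _, hW.const_mem_continuousMembers h1 a, fun _ => rfl⟩,
      by simpa using ha, by simpa using ha'⟩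

/-- Compactness leaves finitely many functions, each positive on a piece of `K`; their maximum is
still negative at `y`. -/
lemma IsBalayageSpace.exists_difference_neg_pos_of_isCompact (hW : IsBalayageSpace W)
    (h1 : (fun _ => 1) ∈ W) {K : Set X} (hK : IsCompact K) {y : X} (hy : y ∉ K) :
    ∃ f ∈ continuousDifferences W, f y < 0 ∧ ∀ x ∈ K, 0 < f x := by
  refine hK.induction_on (p := fun S => ∃ f ∈ continuousDifferences W, f y < 0 ∧ ∀ x ∈ S, 0 < f x)
    ⟨_, IsBalayageSpace.neg_mem_differences (hW.const_mem_differences h1 1), by simp, by simp⟩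
    (fun S T hST ⟨f, hf, h, h'⟩ => ⟨f, hf, h, fun x hx => h' x (hST hx)⟩)
    (fun S T ⟨f, hf, h, h'⟩ ⟨k, hk, e, e'⟩ => ⟨_, hW.sup_mem_differences hf hk, ?_, ?_⟩) ?_
  · exact sup_lt_iff.2 ⟨h, e⟩
  · rintro x (hx | hx)
    exacts [lt_sup_iff.2 (Or.inl (h' x hx)), lt_sup_iff.2 (Or.inr (e' x hx))]
  · intro x hx
    obtain ⟨f, hf, h, h'⟩ := hW.exists_difference_neg_pos h1 (show x ≠ y by rintro rfl; exact hy hx)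
    exact ⟨{z | 0 < f z}, mem_nhdsWithin_of_mem_nhds
      ((isOpen_lt continuous_const (continuous_of_mem_differences hf)).mem_nhds h'),
      f, hf, h, fun _ hz => hz⟩

variable [MeasurableSpace X] [BorelSpace X]

/-- A finite measure that is dominated by another one on the positive differences of continuous
real members of `W` is dominated on compact sets. -/
lemma IsBalayageSpace.measure_le_of_isCompact [SecondCountableTopology X] (hW : IsBalayageSpace W)
    (h1 : (fun _ => 1) ∈ W)
    {σ μ : Measure X} [IsFiniteMeasure μ]
    (h : ∀ f ∈ continuousDifferences W, 0 ≤ f →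
      ∫⁻ x, ENNReal.ofReal (f x) ∂σ ≤ ∫⁻ x, ENNReal.ofReal (f x) ∂μ)
    {K : Set X} (hK : IsCompact K) : σ K ≤ μ K := by
  have hpos : ∀ f ∈ continuousDifferences W, σ {x | 0 < f x} ≤ μ {x | 0 < f x} := by
    intro f hf
    have hmeas : MeasurableSet {x | 0 < f x} :=
      (isOpen_lt continuous_const (continuous_of_mem_differences hf)).measurableSet
    -- These differences increase to the indicator of `{f > 0}`.
    let φ : ℕ → X → ℝ := fun k x => min 1 ((k : ℝ) * max (f x) 0)
    have hφ : ∀ k, φ k ∈ continuousDifferences W := fun k => by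
      have := hW.inf_mem_differences (hW.const_mem_differences h1 1)
        (hW.smul_mem_differences k (hW.sup_mem_differences hf (hW.const_mem_differences h1 0)))
      convert this using 1
      ext x
      simp [φ]
    have hφ0 : ∀ k, 0 ≤ φ k := fun k x => by
      simp only [φ, Pi.zero_apply]
      positivity
    have hind : ∀ x, ⨆ k, ENNReal.ofReal (φ k x) = {x | 0 < f x}.indicator 1 x := by
      intro x
      by_cases hx : 0 < f x
      · rw [indicator_of_mem (show x ∈ {x | 0 < f x} from hx), Pi.one_apply]
        refine le_antisymm (iSup_le fun k => ?_) ?_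
        · exact ENNReal.ofReal_le_one.2 (min_le_left _ _)
        · obtain ⟨k, hk⟩ := exists_nat_gt (1 / f x)
          refine le_iSup_of_le k ?_
          rw [div_lt_iff₀ hx] at hk
          simp [φ, max_eq_left hx.le, min_eq_left hk.le]
      · rw [indicator_of_notMem (show x ∉ {x | 0 < f x} from hx)]
        simp [φ, max_eq_right (not_lt.1 hx)]
    have hlim : ∀ τ : Measure X, τ {x | 0 < f x} = ⨆ k, ∫⁻ x, ENNReal.ofReal (φ k x) ∂τ := by
      intro τ
      rw [← lintegral_iSup, ← lintegral_indicator_one hmeas]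
      · exact lintegral_congr fun x => (hind x).symm
      · exact fun k => (continuous_of_mem_differences (hφ k)).measurable.ennreal_ofReal
      · intro k l hkl x
        refine ENNReal.ofReal_le_ofReal (min_le_min_left _ ?_)
        have : (0 : ℝ) ≤ max (f x) 0 := le_max_right _ _
        gcongr
    rw [hlim σ, hlim μ]
    exact iSup_mono fun k => h _ (hφ k) (hφ0 k)
  by_cases hne : Kᶜ.Nonempty
  swap
  · have : K = {x | 0 < (fun _ : X => ((1 : ℝ≥0) : ℝ)) x} := by
      rw [not_nonempty_iff_eq_empty, compl_empty_iff] at hne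
      simp [hne]
    rw [this]
    exact hpos _ (hW.const_mem_differences h1 1)
  choose! F hF hFneg hFpos using fun y (hy : y ∈ Kᶜ) =>
    hW.exists_difference_neg_pos_of_isCompact h1 hK hy
  -- Countably many of the sets `{F y < 0}` cover `Kᶜ`, so the running minima `Φ k` of the
  -- corresponding functions satisfy `⋂ k, {Φ k > 0} = K`.
  obtain ⟨T, hTK, hTc, hT⟩ := TopologicalSpace.countable_cover_nhdsWithin
    (f := fun y => {x | F y x < 0}) (s := Kᶜ) fun y hy => mem_nhdsWithin_of_mem_nhds
      ((isOpen_lt (continuous_of_mem_differences (hF y hy)) continuous_const).mem_nhds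
        (hFneg y hy))
  have hTne : T.Nonempty := by
    obtain ⟨z, hz⟩ := hne
    obtain ⟨t, ht, -⟩ := mem_iUnion₂.1 (hT hz)
    exact ⟨t, ht⟩
  obtain ⟨s, hs⟩ := hTc.exists_eq_range hTne
  have hsK : ∀ i, s i ∈ Kᶜ := fun i => hTK (hs ▸ mem_range_self i)
  let Φ : ℕ → X → ℝ := fun k => Nat.rec (F (s 0)) (fun i φ => φ ⊓ F (s (i + 1))) k
  have hΦsucc : ∀ k, Φ (k + 1) = Φ k ⊓ F (s (k + 1)) := fun k => rfl
  have hΦ : ∀ k, Φ k ∈ continuousDifferences W := by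
    intro k
    induction k with
    | zero => exact hF _ (hsK 0)
    | succ k ih => exact hW.inf_mem_differences ih (hF _ (hsK _))
  have hΦK : ∀ k, ∀ x ∈ K, 0 < Φ k x := by
    intro k
    induction k with
    | zero => exact hFpos _ (hsK 0)
    | succ k ih => exact fun x hx => lt_inf_iff.2 ⟨ih x hx, hFpos _ (hsK _) x hx⟩
  have hΦle : ∀ k, Φ k ≤ F (s k) := by
    rintro (_ | k)
    exacts [le_rfl, inf_le_right]
  have hanti : Antitone fun k => {x | 0 < Φ k x} := antitone_nat_of_succ_le fun k x hx =>
    (lt_inf_iff.1 (show 0 < (Φ k ⊓ F (s (k + 1))) x from hx)).1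
  have hinter : ⋂ k, {x | 0 < Φ k x} = K := by
    refine subset_antisymm (fun x hx => ?_) (fun x hx => mem_iInter.2 fun k => hΦK k x hx)
    by_contra hxK
    obtain ⟨t, ht, hxt⟩ := mem_iUnion₂.1 (hT hxK)
    rw [hs] at ht
    obtain ⟨i, rfl⟩ := ht
    exact absurd ((mem_iInter.1 hx i).trans_le (hΦle i x)) (not_lt.2 (le_of_lt hxt))
  have hlim := tendsto_measure_iInter_atTop (μ := μ) (s := fun k => {x | 0 < Φ k x})
    (fun k => (isOpen_lt continuous_const
      (continuous_of_mem_differences (hΦ k))).measurableSet.nullMeasurableSet) hanti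
    ⟨0, measure_ne_top _ _⟩
  rw [hinter] at hlim
  exact ge_of_tendsto' hlim fun k => (measure_mono fun x hx => hΦK k x hx).trans (hpos _ (hΦ k))

omit [BorelSpace X] in
/-- Balayage inequality: for `A ⊆ A'`, the difference of the reduced functions of `v ≤ u` on `A`
controls the integral of `u - v` over `A` with respect to the reduced measure of `A'`. -/
lemma IsBalayageSpace.reduced_add_setLIntegral_le (hW : IsBalayageSpace W) {A A' : Set X}
    (hA : MeasurableSet A) (hAA' : A ⊆ A') {y : X} {ν : Measure X}
    (hν : IsReducedMeasure W y A' ν) {u v : X → ℝ≥0∞} (hv : v ∈ W) (hvu : v ≤ u) :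
    reduced W v A y + ∫⁻ x in A, u x ∂ν ≤ reduced W u A y + ∫⁻ x in A, v x ∂ν := by
  conv_rhs => rw [reduced, sInf_apply]
  rw [ENNReal.iInf_add]
  refine le_iInf ?_
  rintro ⟨t, htW, ht⟩
  -- `v ⊓ t` belongs to `W` and equals `v` on `A`, since `v ≤ u ≤ t` there.
  have hR : reduced W v A y ≤ ∫⁻ x in A, v x ∂ν + ∫⁻ x in Aᶜ, t x ∂ν := by
    calc reduced W v A y ≤ reduced W (v ⊓ t) A' y := by
          suffices hsub : {w | w ∈ W ∧ ∀ x ∈ A', (v ⊓ t) x ≤ w x} ⊆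
              {w | w ∈ W ∧ ∀ x ∈ A, v x ≤ w x}  from
            (sInf_le_sInf hsub : reduced W v A ≤ reduced W (v ⊓ t) A') y
          rintro w ⟨hwW, hw⟩
          refine ⟨hwW, fun x hx => ?_⟩
          exact (le_inf le_rfl ((hvu x).trans (ht x hx))).trans (hw x (hAA' hx))
      _ = ∫⁻ x, (v ⊓ t) x ∂ν := (hν _ (hW.inf_mem hv htW)).symm
      _ = ∫⁻ x in A, (v ⊓ t) x ∂ν + ∫⁻ x in Aᶜ, (v ⊓ t) x ∂ν := (lintegral_add_compl _ hA).symm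
      _ ≤ _ := by
          gcongr with x x
          exacts [inf_le_left, inf_le_right]
  have ht' : ∫⁻ x in A, u x ∂ν + ∫⁻ x in Aᶜ, t x ∂ν ≤ t y :=
    calc ∫⁻ x in A, u x ∂ν + ∫⁻ x in Aᶜ, t x ∂ν ≤ ∫⁻ x in A, t x ∂ν + ∫⁻ x in Aᶜ, t x ∂ν := by
          gcongr 1
          exact setLIntegral_mono' hA ht
      _ = reduced W t A' y := by rw [lintegral_add_compl _ hA, hν t htW]
      _ ≤ t y := reduced_le_of_mem htW (fun _ _ => le_rfl) y
  -- The integral of `t` over `Aᶜ` may be infinite; it is absorbed into `t y` and never cancelled.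
  calc reduced W v A y + ∫⁻ x in A, u x ∂ν
      ≤ (∫⁻ x in A, v x ∂ν + ∫⁻ x in Aᶜ, t x ∂ν) + ∫⁻ x in A, u x ∂ν := by gcongr
    _ = (∫⁻ x in A, u x ∂ν + ∫⁻ x in Aᶜ, t x ∂ν) + ∫⁻ x in A, v x ∂ν := by ring
    _ ≤ t y + ∫⁻ x in A, v x ∂ν := by gcongr

omit [TopologicalSpace X] [BorelSpace X] in
lemma IsReducedMeasure.isFiniteMeasure {y : X} {A : Set X} {μ : Measure X}
    (hμ : IsReducedMeasure W y A μ) (h1 : (fun _ => 1) ∈ W) : IsFiniteMeasure μ := by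
  refine ⟨?_⟩
  have h := hμ _ h1
  rw [lintegral_one] at h
  rw [h]
  exact (reduced_le_of_mem h1 (fun _ _ => le_rfl) y).trans_lt ENNReal.one_lt_top

end Lattice

/-! ### Monotonicity of reduced measures. -/

section Metric

variable {X : Type*} [MetricSpace X] [ProperSpace X] [MeasurableSpace X] [BorelSpace X]
  {W : Set (X → ℝ≥0∞)}

/-- On subsets of `A ⊆ A'`, the reduced measure of `A'` is dominated by that of `A`. -/
lemma IsReducedMeasure.measure_le (hW : IsBalayageSpace W) (h1 : (fun _ => 1) ∈ W)
    {A A' : Set X} (hA : MeasurableSet A) (hAA' : A ⊆ A') {y : X} {μ ν : Measure X}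
    (hμ : IsReducedMeasure W y A μ) (hν : IsReducedMeasure W y A' ν) {E : Set X}
    (hE : MeasurableSet E) (hEA : E ⊆ A) : ν E ≤ μ E := by
  have := hμ.isFiniteMeasure h1
  have := hν.isFiniteMeasure h1
  rw [hE.measure_eq_iSup_isCompact_of_ne_top (measure_ne_top ν E)]
  refine iSup₂_le fun K hKE => iSup_le fun hK => ?_
  refine le_trans ?_ (measure_mono hKE)
  rw [← Measure.restrict_eq_self ν (hKE.trans hEA)]
  refine hW.measure_le_of_isCompact h1 ?_ hK
  rintro f ⟨u, hu, v, hv, hf⟩ hf0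
  have hvu : ∀ x, v x ≤ u x := fun x => by
    have := hf0 x
    rw [hf x] at this
    exact_mod_cast sub_nonneg.1 this
  have hsub : ∀ x, ENNReal.ofReal (f x) = (u x : ℝ≥0∞) - v x := fun x => by
    rw [hf x, ENNReal.ofReal_sub (u x : ℝ) (v x).coe_nonneg]
    simp
  have hint : ∀ w ∈ continuousMembers W, ∫⁻ x, (w x : ℝ≥0∞) ∂μ ≠ ∞ ∧
      ∫⁻ x in A, (w x : ℝ≥0∞) ∂ν ≠ ∞ := by
    intro w hw
    refine ⟨?_, ?_⟩
    · rw [hμ _ hw.2]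
      exact ((reduced_le_of_mem hw.2 (fun _ _ => le_rfl) y).trans_lt ENNReal.coe_lt_top).ne
    · refine ((setLIntegral_le_lintegral _ _).trans_lt ?_).ne
      rw [hν _ hw.2]
      exact (reduced_le_of_mem hw.2 (fun _ _ => le_rfl) y).trans_lt ENNReal.coe_lt_top
  have hvm : Measurable fun x => (v x : ℝ≥0∞) := hv.1.measurable.coe_nnreal_ennreal
  have hle : ∀ x, (v x : ℝ≥0∞) ≤ u x := fun x => by exact_mod_cast hvu x
  have hmain := hW.reduced_add_setLIntegral_le hA hAA' hν hv.2 hle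
  rw [← hμ _ hu.2, ← hμ _ hv.2] at hmain
  simp only [hsub]
  rw [lintegral_sub hvm (hint v hv).2 (ae_of_all _ hle),
    lintegral_sub hvm (hint v hv).1 (ae_of_all _ hle)]
  rw [tsub_le_iff_right]
  have h2 : ∫⁻ x, (v x : ℝ≥0∞) ∂μ ≤ ∫⁻ x, (u x : ℝ≥0∞) ∂μ := lintegral_mono hle
  refine (ENNReal.add_le_add_iff_left (hint v hv).1).1 (hmain.trans_eq ?_)
  rw [← add_assoc, add_tsub_cancel_of_le h2]

end Metric

/-! ### Existence of reduced measures, finiteness of `g`, and directions. -/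

section Normed

variable {V : Type*} [NormedAddCommGroup V] [NormedSpace ℝ V] [MeasurableSpace V]
  {W : Set (V → ℝ≥0∞)} {G : V → V → ℝ≥0∞}

/-- If there is a Green function, then the reduced measure of the complement of a ball exists. -/
lemma IsGreenFunction.isReducedMeasure_ball [ProperSpace V] [Nontrivial V] (hG : IsGreenFunction W G) {y : V}
    {r : ℝ} (hr : 0 < r) :
    IsReducedMeasure W y (Metric.ball y r)ᶜ (reducedMeasure W y (Metric.ball y r)ᶜ) := by
  have hex : ∃ μ : Measure V, IsReducedMeasure W y (Metric.ball y r)ᶜ μ := by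
    -- Otherwise `reducedMeasure` takes its default value 0, and the mean value property of `G(·, y
    -- + e)`, whose pole lies outside the closed ball, would give `G y (y + e) = 0`.
    by_contra hne
    obtain ⟨e, he⟩ := NormedSpace.exists_lt_norm ℝ V r
    have hcl : closure (Metric.ball y r) ⊆ Metric.closedBall y r :=
      Metric.closure_ball_subset_closedBall
    have h := (hG.isHarmonicOn (y + e)).mean_value (Metric.ball y r) Metric.isOpen_ball
      ((isCompact_closedBall y r).of_isClosed_subset isClosed_closure hcl)
      (by
        rintro z hz rfl
        have := hcl hz
        rw [Metric.mem_closedBall, dist_eq_norm, add_sub_cancel_left] at this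
        linarith) y (Metric.mem_ball_self hr)
    rw [reducedMeasure, dif_neg hne, lintegral_zero_measure] at h
    exact (hG.pos y (y + e)).ne h
  rw [reducedMeasure, dif_pos hex]
  exact hex.choose_spec

/-- A nontrivial normed space has points at every distance `s > 0` from the pole, where `G` is
finite. -/
lemma GreenAssumption.ne_top [Nontrivial V] {g : ℝ≥0 → ℝ≥0∞} {R₀ : ℝ≥0∞} (hG : GreenAssumption W G g R₀)
    {s : ℝ≥0} (hs : 0 < s) : g s ≠ ∞ := by
  obtain ⟨c, -, hcomp⟩ := hG.comparable
  obtain ⟨e, he⟩ := exists_norm_eq V s.2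
  have hd : nndist e 0 = s := by
    ext
    rw [coe_nndist, dist_zero_right, he]
    rfl
  have hne : e ≠ 0 := by
    rintro rfl
    simp at hd
    exact hs.ne hd
  have hfin := (hG.isGreenFunction.isHarmonicOn 0).ne_top e hne
  have h := (hcomp e 0).1
  rw [hd] at h
  intro htop
  rw [htop, ENNReal.mul_top (by simp)] at h
  exact hfin (top_le_iff.1 h)

omit [MeasurableSpace V] in
/-- A point of a dense set that is close to `y` and lies in the direction of `w`. -/
lemma exists_mem_dense_dist_lt {D : ℕ → V} (hD : DenseRange D) {y w : V} {a : ℝ} (ha : 0 < a)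
    (hw : 4 * a ≤ dist y w) :
    ∃ i, dist (D i) y < 5 * a ∧ dist (D i) w < dist y w - 3 * a := by
  have h0 : 0 < dist y w := by linarith
  -- Approximate within `a` the point of the segment at distance `4a` from `y`.
  obtain ⟨i, hi⟩ := hD.exists_dist_lt (AffineMap.lineMap y w (4 * a / dist y w)) ha
  rw [dist_comm] at hi
  have h1 : dist (AffineMap.lineMap y w (4 * a / dist y w)) y = 4 * a := by
    rw [dist_lineMap_left, Real.norm_of_nonneg (by positivity)]
    field_simp
  have h2 : dist (AffineMap.lineMap y w (4 * a / dist y w)) w = dist y w - 4 * a := by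
    rw [dist_lineMap_right, Real.norm_of_nonneg (by rw [sub_nonneg, div_le_one h0]; exact hw)]
    field_simp
  refine ⟨i, ?_, ?_⟩
  · linarith [dist_triangle (D i) (AffineMap.lineMap y w (4 * a / dist y w)) y]
  · linarith [dist_triangle (D i) (AffineMap.lineMap y w (4 * a / dist y w)) w]

end Normed

/-! ### Bounds for the Green function of a ball and scaling of `g`. -/

section Green

variable {X : Type*} [MetricSpace X] [MeasurableSpace X]
  {W : Set (X → ℝ≥0∞)} {G : X → X → ℝ≥0∞} {g : ℝ≥0 → ℝ≥0∞} {R₀ : ℝ≥0∞}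

omit [MeasurableSpace X] in
/-- Near the center of a ball the Green function of the ball is bounded below. -/
lemma le_greenOn_ball (hW : IsBalayageSpace W) (h1 : (fun _ => 1) ∈ W) (hanti : Antitone g)
    {c : ℝ≥0} (hcomp : ∀ x y, (c : ℝ≥0∞)⁻¹ * g (nndist x y) ≤ G x y ∧ G x y ≤ c * g (nndist x y))
    (hc : c ≠ 0) {s t : ℝ≥0} (hfin : g t ≠ ∞) (hst : c * g s ≤ (c : ℝ≥0∞)⁻¹ * g t / 2) (hts : t ≤ s) {y z : X}
    (hz : dist y z < t) :
    (c : ℝ≥0∞)⁻¹ * g t / 2 ≤ greenOn W G (Metric.ball y (2 * s)) y z := by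
  have hR : reduced W (fun w => G w z) (Metric.ball y (2 * s))ᶜ y ≤ c * g s := by
    lift g s to ℝ≥0 using ((hanti hts).trans_lt hfin.lt_top).ne with a ha
    rw [← ENNReal.coe_mul]
    -- The constant `c * g s` is a competitor: off the ball, `w` has distance at least `2s - t ≥ s`
    -- from `z`.
    refine reduced_le_of_mem (hW.const_mem h1 (c * a)) (fun w hw => ?_) y
    refine (hcomp w z).2.trans ?_
    rw [ENNReal.coe_mul, ha]
    gcongr
    apply hanti
    rw [← NNReal.coe_le_coe, coe_nndist]
    rw [mem_compl_iff, Metric.mem_ball, not_lt] at hw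
    have := dist_triangle w z y
    rw [dist_comm z y] at this
    have : (t : ℝ) ≤ s := hts
    linarith
  have hlow : (c : ℝ≥0∞)⁻¹ * g t ≤ G y z := by
    refine le_trans ?_ (hcomp y z).1
    gcongr
    apply hanti
    rw [← NNReal.coe_le_coe, coe_nndist]
    exact hz.le
  rw [greenOn]
  refine le_trans ?_ (tsub_le_tsub hlow (hR.trans hst))
  rw [ENNReal.sub_half (ENNReal.mul_ne_top (by simpa using hc) hfin)]

/-- Iterate the decay `k` times, with `η₀ ^ k < ε`. -/
lemma GreenAssumption.exists_scale (hG : GreenAssumption W G g R₀) {ε : ℝ≥0} (hε : 0 < ε) :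
    ∃ κ : ℝ≥0, 0 < κ ∧ κ ≤ 1 ∧ ∀ s : ℝ≥0, 0 < s → (s : ℝ≥0∞) < R₀ → g s ≤ ε * g (κ * s) := by
  obtain ⟨a, η, ha, ha1, hη, hη1, hdec⟩ := hG.decay
  obtain ⟨k, hk⟩ := exists_pow_lt_of_lt_one hε hη1
  have hpow : ∀ j : ℕ, ∀ s : ℝ≥0, 0 < s → (s : ℝ≥0∞) < R₀ → g s ≤ (η ^ j : ℝ≥0) * g (a ^ j * s) := by
    intro j
    induction j with
    | zero => simp
    | succ j ih =>
      intro s hs hsR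
      have hle : a ^ j * s ≤ s := mul_le_of_le_one_left' (pow_le_one₀ ha.le ha1.le)
      have h := hdec (a ^ j * s) (by positivity) ((ENNReal.coe_le_coe.2 hle).trans_lt hsR)
      calc g s ≤ (η ^ j : ℝ≥0) * g (a ^ j * s) := ih s hs hsR
        _ ≤ (η ^ j : ℝ≥0) * (η * g (a * (a ^ j * s))) := by gcongr
        _ = _ := by rw [pow_succ, pow_succ', ENNReal.coe_mul]; ring_nf
  refine ⟨a ^ k, by positivity, pow_le_one₀ ha.le ha1.le, fun s hs hsR => (hpow k s hs hsR).trans ?_⟩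
  gcongr

lemma GreenAssumption.exists_doubling_eight (hG : GreenAssumption W G g R₀) :
    ∃ c : ℝ≥0, 0 < c ∧ ∀ s : ℝ≥0, 0 < s → (s : ℝ≥0∞) < R₀ → g (s / 8) ≤ c * g s := by
  obtain ⟨c, hc, hdoub⟩ := hG.doubling
  refine ⟨c ^ 3, by positivity, fun s hs hsR => ?_⟩
  have hlt : ∀ b : ℝ≥0, 1 ≤ b → ((s / b : ℝ≥0) : ℝ≥0∞) < R₀ := fun b hb =>
    (ENNReal.coe_le_coe.2 (div_le_self zero_le hb)).trans_lt hsR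
  have h2 := hdoub (s / 2) (by positivity) (hlt 2 one_le_two)
  have h4 := hdoub (s / 4) (by positivity) (hlt 4 (by norm_num))
  calc g (s / 8) = g (s / 4 / 2) := by rw [div_div]; norm_num
    _ ≤ c * g (s / 4) := h4
    _ = c * g (s / 2 / 2) := by rw [div_div s 2 2]; norm_num
    _ ≤ c * (c * (c * g s)) := by gcongr; exact h2.trans (by gcongr; exact hdoub s hs hsR)
    _ = _ := by push_cast; ring

end Green

/-! ### The two halves of the Ikeda-Watanabe estimate. -/

section IkedaWatanabe

variable {X : Type*} [MetricSpace X] [MeasurableSpace X]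
  {W : Set (X → ℝ≥0∞)} {G : X → X → ℝ≥0∞} {lam : Measure X}
  {N : ProbabilityTheory.Kernel X X} {C : ℝ≥0}

lemma le_of_ikedaWatanabe_left (hG : Measurable (Function.uncurry G)) {x : X} {r : ℝ}
    {F : Set X} {m : ℝ≥0∞} (hC : C ≠ 0)
    (h : (C : ℝ≥0∞)⁻¹ * m ≤ ∫⁻ z in Metric.ball x r, greenOn W G (Metric.ball x r) x z * N z F ∂lam)
    {K I : ℝ≥0∞} (hK : ∀ z ∈ Metric.ball x r, N z F ≤ K) [OpensMeasurableSpace X]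
    (hI : ∫⁻ z in Metric.ball x r, G x z ∂lam ≤ I) : m ≤ C * (I * K) := by
  rw [ENNReal.inv_mul_le_iff (by simpa using hC) (by simp)] at h
  refine h.trans (mul_le_mul_right ?_ _)
  calc ∫⁻ z in Metric.ball x r, greenOn W G (Metric.ball x r) x z * N z F ∂lam
      ≤ ∫⁻ z in Metric.ball x r, G x z * K ∂lam :=
        setLIntegral_mono' Metric.isOpen_ball.measurableSet
          fun z hz => mul_le_mul' tsub_le_self (hK z hz)
    _ = (∫⁻ z in Metric.ball x r, G x z ∂lam) * K :=
        lintegral_mul_const _ (hG.comp measurable_prodMk_left)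
    _ ≤ I * K := by gcongr

lemma le_of_ikedaWatanabe_right [OpensMeasurableSpace X] {y q : X} {a ρ : ℝ} {F : Set X}
    {m : ℝ≥0∞}
    (h : ∫⁻ z in Metric.ball y ρ, greenOn W G (Metric.ball y ρ) y z * N z F ∂lam ≤ C * m)
    (hqy : Metric.ball q a ⊆ Metric.ball y ρ) {T K : ℝ≥0∞} {C' : ℝ≥0}
    (hT : ∀ z ∈ Metric.ball q a, T ≤ greenOn W G (Metric.ball y ρ) y z)
    (hK : ∀ z ∈ Metric.ball q a, K ≤ C' * N z F) :
    T * K * lam (Metric.ball q a) ≤ C' * (C * m) :=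
  calc T * K * lam (Metric.ball q a) = ∫⁻ _ in Metric.ball q a, T * K ∂lam :=
        (setLIntegral_const _ _).symm
    _ ≤ ∫⁻ z in Metric.ball q a, C' * (greenOn W G (Metric.ball y ρ) y z * N z F) ∂lam := by
        refine setLIntegral_mono' Metric.isOpen_ball.measurableSet fun z hz => ?_
        rw [mul_left_comm]
        exact mul_le_mul' (hT z hz) (hK z hz)
    _ = C' * ∫⁻ z in Metric.ball q a, greenOn W G (Metric.ball y ρ) y z * N z F ∂lam :=
        lintegral_const_mul' _ _ ENNReal.coe_ne_top
    _ ≤ C' * ∫⁻ z in Metric.ball y ρ, greenOn W G (Metric.ball y ρ) y z * N z F ∂lam :=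
        mul_le_mul_right (lintegral_mono_set hqy) _
    _ ≤ C' * (C * m) := mul_le_mul_right h _

end IkedaWatanabe

/-! ### Comparison of the jump kernel at different points. -/

section Density

variable {X : Type*} [MetricSpace X] [MeasurableSpace X] {N : ProbabilityTheory.Kernel X X}
  {lamt : Measure X} {n : X → X → ℝ≥0} {n₀ : ℝ≥0 → ℝ≥0} {C C₀ : ℝ≥0}

/-- For an almost decreasing jump density, the kernel charges a set more from points that are
closer to it. -/
lemma kernel_le_of_dist_lt (hNn : ∀ y, N y = lamt.withDensity (fun z => (n y z : ℝ≥0∞)))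
    (hC : C ≠ 0)
    (hn : ∀ x y, x ≠ y → C⁻¹ * n₀ (nndist x y) ≤ n x y ∧ n x y ≤ C * n₀ (nndist x y))
    (hn₀ : ∀ r s : ℝ≥0, 0 < r → r < s → s < 2 * r → n₀ s ≤ C₀ * n₀ r)
    {F : Set X} (hF : MeasurableSet F) {z z' : X}
    (hz : ∀ w ∈ F, 0 < dist z w ∧ dist z w < dist z' w ∧ dist z' w < 2 * dist z w) :
    N z' F ≤ (C * C₀ * C : ℝ≥0) * N z F := by
  rw [hNn, hNn, withDensity_apply _ hF, withDensity_apply _ hF,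
    ← lintegral_const_mul' _ _ ENNReal.coe_ne_top]
  refine setLIntegral_mono' hF fun w hw => ?_
  obtain ⟨h0, h1, h2⟩ := hz w hw
  rw [← ENNReal.coe_mul, ENNReal.coe_le_coe]
  calc n z' w ≤ C * n₀ (nndist z' w) := (hn z' w (dist_pos.1 (h0.trans h1))).2
    _ ≤ C * (C₀ * n₀ (nndist z w)) := by
        gcongr
        exact hn₀ _ _ h0 h1 h2
    _ ≤ C * (C₀ * (C * n z w)) := by
        gcongr
        rw [← inv_mul_le_iff₀ (pos_iff_ne_zero.2 hC)]
        exact (hn z w (dist_pos.1 h0)).1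
    _ = C * C₀ * C * n z w := by ring

end Density

/-! ### Decomposition into directions and the main estimate. -/

section Normed

variable {V : Type*} [NormedAddCommGroup V] [NormedSpace ℝ V] [FiniteDimensional ℝ V]
  [MeasurableSpace V] [BorelSpace V] {W : Set (V → ℝ≥0∞)}

/-- To compare two measures on a set away from `y`, it suffices to compare them on the parts of
it that are seen from `y` in a given direction. -/
lemma measure_le_mul_of_directions {μ ν : Measure V} {c : ℝ≥0∞} {y : V} {a : ℝ} (ha : 0 < a)
    {E : Set V} (hE : MeasurableSet E) (hEy : ∀ w ∈ E, 4 * a ≤ dist y w)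
    (h : ∀ q : V, dist q y < 5 * a → ∀ F : Set V, MeasurableSet F → F ⊆ E →
      (∀ w ∈ F, dist q w < dist y w - 3 * a) → μ F ≤ c * ν F) :
    μ E ≤ c * ν E := by
  let D := TopologicalSpace.denseSeq V
  -- The condition on `D i` alone makes `S i` empty when `D i` is far from `y`.
  let S : ℕ → Set V := fun i => {w | w ∈ E ∧ dist (D i) y < 5 * a ∧ dist (D i) w < dist y w - 3 * a}
  have hS : ∀ i, MeasurableSet (S i) := fun i => by
    have hlt : MeasurableSet {w | dist (D i) w < dist y w - 3 * a} :=
      measurableSet_lt (by fun_prop) (by fun_prop)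
    exact hE.inter ((MeasurableSet.const _).inter hlt)
  have hES : E = ⋃ i, disjointed S i := by
    rw [iUnion_disjointed]
    refine subset_antisymm (fun w hw => ?_) (iUnion_subset fun i w hw => hw.1)
    obtain ⟨i, hi⟩ := exists_mem_dense_dist_lt (TopologicalSpace.denseRange_denseSeq V) ha
      (hEy w hw)
    exact mem_iUnion.2 ⟨i, hw, hi⟩
  have hmeas : ∀ i, MeasurableSet (disjointed S i) := fun i => MeasurableSet.disjointed hS i
  rw [hES, measure_iUnion (disjoint_disjointed S) hmeas,
    measure_iUnion (disjoint_disjointed S) hmeas, ← ENNReal.tsum_mul_left]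
  refine ENNReal.tsum_le_tsum fun i => ?_
  have hsub := disjointed_subset S i
  rcases (disjointed S i).eq_empty_or_nonempty with he | ⟨w, hw⟩
  · simp [he]
  · exact h (D i) (hsub hw).2.1 _ (hmeas i) (fun v hv => (hsub hv).1) fun v hv => (hsub hv).2.2

theorem jumpAssumption_of_almost_decreasing [Nontrivial V] {lam : Measure V}
    [lam.IsAddHaarMeasure]
    (hW : IsBalayageSpace W) (h_one : (fun _ => 1) ∈ W) {G : V → V → ℝ≥0∞}
    {g : ℝ≥0 → ℝ≥0∞} {R₀ : ℝ≥0∞} (hG : GreenAssumption W G g R₀)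
    {N : ProbabilityTheory.Kernel V V} (hN : IkedaWatanabeEstimate W G R₀ lam N)
    {CG : ℝ≥0} (hmean : ∀ (x : V) (r : ℝ≥0), 0 < r → (r : ℝ≥0∞) < R₀ → ∀ w : V,
      (lam (Metric.ball x r))⁻¹ * ∫⁻ y in Metric.ball x r, G w y ∂lam ≤ CG * g r)
    {lamt : Measure V} {n : V → V → ℝ≥0}
    (hNn : ∀ y, N y = lamt.withDensity (fun z => (n y z : ℝ≥0∞))) {n₀ : ℝ≥0 → ℝ≥0}
    {C C₀ : ℝ≥0} (hC : C ≠ 0)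
    (hn : ∀ x y, x ≠ y → C⁻¹ * n₀ (nndist x y) ≤ n x y ∧ n x y ≤ C * n₀ (nndist x y))
    (hn₀ : ∀ r s : ℝ≥0, 0 < r → r < s → s < 2 * r → n₀ s ≤ C₀ * n₀ r) :
    JumpAssumption W := by
  obtain ⟨M, CN, hM, hCN, hIW⟩ := hN
  obtain ⟨c, hc, hcomp⟩ := hG.comparable
  have hc0 : 0 < c := one_pos.trans_le hc
  have hM0 : 0 < M := three_pos.trans_le hM
  -- This `ε` turns decay into `c * g s ≤ c⁻¹ * g (κ * s) / 2`, as `le_greenOn_ball` requires.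
  obtain ⟨κ, hκ0, hκ1, hκ⟩ := hG.exists_scale (ε := c⁻¹ * c⁻¹ / 2) (by positivity)
  obtain ⟨c₈, hc₈, h₈⟩ := hG.exists_doubling_eight
  have : ProperSpace V := FiniteDimensional.proper_real V
  let cJ : ℝ≥0 := CN * (CG * c₈ * (2 * c)) * ((C * C₀ * C) * CN)
  -- With `s = r / (2M)`, this `α` gives `8a = κ s`, while `M * (2s) = r` makes the estimate on
  -- `B(y, 2s)` valid on all of `B(y, r)ᶜ`. The added 1 ensures a positive constant.
  refine ⟨R₀, cJ + 1, κ / (16 * M), hG.R₀_pos, by positivity, by positivity, ?_, ?_⟩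
  · rw [div_lt_div_iff₀ (by positivity) two_pos]
    calc κ * 2 ≤ 1 * 2 := by gcongr
      _ < 1 * (16 * 3) := by norm_num
      _ ≤ 1 * (16 * M) := by gcongr
  intro x r hr hrR y hy E hE hEy
  set a : ℝ≥0 := κ / (16 * M) * r with ha
  set s : ℝ≥0 := r / (2 * M) with hs
  have ha0 : 0 < a := by positivity
  have hs0 : 0 < s := by positivity
  have hκs : κ * s = 8 * a := by
    rw [ha, hs]
    field_simp
    norm_num
  have hMs : M * (2 * s) = r := by
    rw [hs]
    field_simp
  have h8a : 8 * a ≤ s := hκs ▸ mul_le_of_le_one_left' hκ1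
  have hsr : 6 * s ≤ r := by
    rw [← hMs, ← mul_assoc]
    gcongr
    calc (6 : ℝ≥0) = 3 * 2 := by norm_num
      _ ≤ M * 2 := by gcongr
  have hMa : M * a * 16 ≤ r := by
    rw [← hMs]
    calc M * a * 16 = M * (2 * (8 * a)) := by ring
      _ ≤ _ := by gcongr
  have hlt : ∀ b : ℝ≥0, b ≤ r → (b : ℝ≥0∞) < R₀ := fun b hb =>
    (ENNReal.coe_le_coe.2 hb).trans_lt hrR
  have ha0' : (0 : ℝ) < a := ha0
  have h8a' : 8 * (a : ℝ) ≤ s := by exact_mod_cast h8a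
  have hsr' : 6 * (s : ℝ) ≤ r := by exact_mod_cast hsr
  have hMa' : M * (a : ℝ) * 16 ≤ r := by exact_mod_cast hMa
  have hr' : (0 : ℝ) < r := hr
  have hball : ((κ / (16 * M) : ℝ≥0) : ℝ) * (r : ℝ) = a := by rw [ha]; push_cast; rfl
  rw [hball] at hy ⊢
  have hxy : dist x y < a := by rwa [dist_comm]
  have hEdist : ∀ w ∈ E, (r : ℝ) ≤ dist y w := fun w hw => by
    rw [dist_comm]
    exact not_lt.1 (hEy hw)
  have hmono : reducedMeasure W y (Metric.ball y ((2 * s : ℝ≥0) : ℝ))ᶜ E ≤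
      reducedMeasure W y (Metric.ball y r)ᶜ E := by
    refine (hG.isGreenFunction.isReducedMeasure_ball hr').measure_le hW h_one
      Metric.isOpen_ball.measurableSet.compl ?_
      (hG.isGreenFunction.isReducedMeasure_ball (by positivity)) hE hEy
    refine compl_subset_compl.2 (Metric.ball_subset_ball ?_)
    push_cast
    linarith
  suffices hmain : reducedMeasure W x (Metric.ball x a)ᶜ E ≤
      cJ * reducedMeasure W y (Metric.ball y ((2 * s : ℝ≥0) : ℝ))ᶜ E by
    refine hmain.trans (mul_le_mul' ?_ hmono)
    exact_mod_cast le_self_add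
  refine measure_le_mul_of_directions ha0' hE (fun w hw => by linarith [hEdist w hw]) ?_
  intro q hq F hF hFE hFq
  have hFdist : ∀ w ∈ F, (r : ℝ) ≤ dist y w := fun w hw => hEdist w (hFE hw)
  have hcompare : ∀ z ∈ Metric.ball q (a : ℝ), ∀ z' ∈ Metric.ball x (a : ℝ),
      N z' F ≤ (C * C₀ * C : ℝ≥0) * N z F := by
    intro z hz z' hz'
    rw [Metric.mem_ball] at hz hz'
    refine kernel_le_of_dist_lt hNn hC hn hn₀ hF fun w hw => ?_
    have h1 := hFdist w hw
    have h2 := hFq w hw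
    have h3 := dist_triangle z q w
    have h4 := dist_triangle4 y x z' w
    have h5 := dist_triangle4 z' x y w
    have h6 := dist_triangle4 y q z w
    rw [dist_comm y x, dist_comm x z'] at h4
    rw [dist_comm y q, dist_comm q z] at h6
    -- With `D = dist y w ≥ r ≥ 48a`: `D - 6a < dist z w < D - 2a < dist z' w < D + 2a`, and `D + 2a
    -- ≤ 2 (D - 6a)`.
    refine ⟨?_, ?_, ?_⟩ <;> linarith
  have hFx : F ⊆ (Metric.ball x ((M * a : ℝ≥0) : ℝ))ᶜ := fun w hw => by
    rw [mem_compl_iff, Metric.mem_ball, not_lt, dist_comm, NNReal.coe_mul]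
    linarith [hFdist w hw, dist_triangle y x w, dist_comm y x]
  have hup := (hIW x a ha0 (hlt a (by
    rw [← NNReal.coe_le_coe]
    linarith)) F hF (by exact_mod_cast hFx)).1
  have hlow := (hIW y (2 * s) (by positivity) (hlt _ (by
    rw [← NNReal.coe_le_coe]
    push_cast
    linarith)) F hF (by
      refine (hFE.trans hEy).trans (compl_subset_compl.2 ?_)
      rw [← NNReal.coe_mul, hMs])).2
  set K : ℝ≥0∞ := ⨆ z ∈ Metric.ball x (a : ℝ), N z F with hK
  set L := lam (Metric.ball x (a : ℝ)) with hL
  have hL0 : L ≠ 0 := (Metric.measure_ball_pos lam x ha0').ne'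
  have hLtop : L ≠ ∞ := measure_ball_lt_top.ne
  have hI : ∫⁻ z in Metric.ball x (a : ℝ), G x z ∂lam ≤ L * (CG * (c₈ * g (8 * a))) := by
    have h := hmean x a ha0 (hlt a (by
      rw [← NNReal.coe_le_coe]
      linarith)) x
    rw [ENNReal.inv_mul_le_iff hL0 hLtop] at h
    refine h.trans ?_
    gcongr
    have := h₈ (8 * a) (by positivity) (hlt _ (h8a.trans (by
      rw [← NNReal.coe_le_coe]
      linarith)))
    rwa [mul_div_cancel_left₀ a (by norm_num : (8 : ℝ≥0) ≠ 0)] at this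
  have hup' := le_of_ikedaWatanabe_left hG.isGreenFunction.measurable (one_pos.trans_le hCN).ne'
    hup (K := K) (fun z hz => le_iSup₂_of_le z hz le_rfl) hI
  have hscale : c * g s ≤ (c : ℝ≥0∞)⁻¹ * g (8 * a) / 2 := by
    have h := hκ s hs0 (hlt _ (by
      rw [← NNReal.coe_le_coe]
      linarith))
    rw [hκs] at h
    calc c * g s ≤ c * ((c⁻¹ * c⁻¹ / 2 : ℝ≥0) * g (8 * a)) := by gcongr
      _ = ((c * (c⁻¹ * c⁻¹ / 2) : ℝ≥0) : ℝ≥0∞) * g (8 * a) := by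
          rw [ENNReal.coe_mul, mul_assoc]
      _ = ((c⁻¹ / 2 : ℝ≥0) : ℝ≥0∞) * g (8 * a) := by
          congr 2
          field_simp
      _ = _ := by
          rw [ENNReal.coe_div two_ne_zero, ENNReal.coe_inv hc0.ne', ENNReal.div_eq_inv_mul,
            ENNReal.div_eq_inv_mul, mul_assoc]
          rfl
  have hqz : ∀ z ∈ Metric.ball q (a : ℝ), dist y z < ((8 * a : ℝ≥0) : ℝ) := fun z hz => by
    rw [Metric.mem_ball] at hz
    push_cast
    linarith [dist_triangle y q z, dist_comm y q, dist_comm q z]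
  have hlow' := le_of_ikedaWatanabe_right hlow (q := q) (a := a) (K := K) (C' := C * C₀ * C)
    (T := (c : ℝ≥0∞)⁻¹ * g (8 * a) / 2)
    (fun z hz => by
      rw [Metric.mem_ball']
      refine (hqz z hz).trans_le ?_
      push_cast
      linarith)
    (fun z hz => by
      have := le_greenOn_ball hW h_one hG.g_antitone hcomp hc0.ne' (hG.ne_top (by positivity))
        hscale h8a (hqz z hz)
      exact_mod_cast this)
    (fun z hz => iSup₂_le fun z' hz' => hcompare z hz z' hz')
  -- By translation invariance `B(q, a)` and `B(x, a)` have the same volume `L`.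
  rw [Measure.addHaar_ball_center, ← Measure.addHaar_ball_center lam x, ← hL] at hlow'
  have hg : g (8 * a) = 2 * c * ((c : ℝ≥0∞)⁻¹ * g (8 * a) / 2) := by
    rw [ENNReal.div_eq_inv_mul]
    calc g (8 * a) = (2 * 2⁻¹) * (c * (c : ℝ≥0∞)⁻¹) * g (8 * a) := by
          rw [ENNReal.mul_inv_cancel (by simp) (by simp),
            ENNReal.mul_inv_cancel (by simpa using hc0.ne') (by simp), one_mul, one_mul]
      _ = _ := by ring
  calc reducedMeasure W x (Metric.ball x a)ᶜ F
      ≤ CN * (L * (CG * (c₈ * g (8 * a))) * K) := hup'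
    _ = CN * (L * (CG * (c₈ * (2 * c * ((c : ℝ≥0∞)⁻¹ * g (8 * a) / 2)))) * K) := by rw [← hg]
    _ = CN * (CG * c₈ * (2 * c)) * ((c : ℝ≥0∞)⁻¹ * g (8 * a) / 2 * K * L) := by ring
    _ ≤ CN * (CG * c₈ * (2 * c)) * ((C * C₀ * C : ℝ≥0) *
          (CN * reducedMeasure W y (Metric.ball y ((2 * s : ℝ≥0) : ℝ))ᶜ F)) := by gcongr
    _ = cJ * reducedMeasure W y (Metric.ball y ((2 * s : ℝ≥0) : ℝ))ᶜ F := by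
        simp only [cJ]
        push_cast
        ring

-- The case `d = 0`: complements of balls are empty.
omit [NormedSpace ℝ V] [FiniteDimensional ℝ V] [BorelSpace V] in
lemma jumpAssumption_of_subsingleton [Subsingleton V] : JumpAssumption W := by
  refine ⟨⊤, 1, 1 / 4, ENNReal.zero_lt_top, one_pos, by positivity, ?_, ?_⟩
  · exact div_lt_div_of_pos_left one_pos two_pos (by norm_num)
  intro x r hr _ y _ E _ hE
  have : E = ∅ := eq_empty_of_forall_notMem fun w hw =>
    hE hw (Subsingleton.elim y w ▸ Metric.mem_ball_self hr)
  simp [this]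

end Normed

end PotentialTheory

theorem corollary7p4 (d : ℕ)
    (W : Set (EuclideanSpace ℝ (Fin d) → ℝ≥0∞))
    (hW : PotentialTheory.IsBalayageSpace W) (h_one : (fun _ => 1) ∈ W)
    (G : EuclideanSpace ℝ (Fin d) → EuclideanSpace ℝ (Fin d) → ℝ≥0∞)
    (g : ℝ≥0 → ℝ≥0∞) (R₀ : ℝ≥0∞)
    (hG : PotentialTheory.GreenAssumption W G g R₀)
    (N : ProbabilityTheory.Kernel (EuclideanSpace ℝ (Fin d)) (EuclideanSpace ℝ (Fin d)))
    (hN : PotentialTheory.IkedaWatanabeEstimate W G R₀ volume N)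
    (hmean : ∃ CG : ℝ≥0, 1 ≤ CG ∧ ∀ (x : EuclideanSpace ℝ (Fin d)) (r : ℝ≥0),
      0 < r → (r : ℝ≥0∞) < R₀ → ∀ w : EuclideanSpace ℝ (Fin d),
        (volume (Metric.ball x r))⁻¹ * ∫⁻ y in Metric.ball x r, G w y ≤ CG * g r)
    (lamt : Measure (EuclideanSpace ℝ (Fin d)))
    (n : EuclideanSpace ℝ (Fin d) → EuclideanSpace ℝ (Fin d) → ℝ≥0)
    (hn_meas : Measurable (Function.uncurry n))
    (hNn : ∀ y, N y = lamt.withDensity (fun z => (n y z : ℝ≥0∞)))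
    (n₀ : ℝ≥0 → ℝ≥0)
    (hn : ∃ C : ℝ≥0, 1 ≤ C ∧ ∀ x y, x ≠ y →
      C⁻¹ * n₀ (nndist x y) ≤ n x y ∧ n x y ≤ C * n₀ (nndist x y))
    (hn₀ : ∃ C₀ : ℝ≥0, 1 ≤ C₀ ∧ ∀ r s : ℝ≥0, 0 < r → r < s → s < 2 * r → n₀ s ≤ C₀ * n₀ r) :
    PotentialTheory.JumpAssumption W := by
  obtain ⟨CG, -, hmean⟩ := hmean
  obtain ⟨C, hC, hn⟩ := hn
  obtain ⟨C₀, -, hn₀⟩ := hn₀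
  rcases subsingleton_or_nontrivial (EuclideanSpace ℝ (Fin d)) with h | h
  · exact PotentialTheory.jumpAssumption_of_subsingleton
  · exact PotentialTheory.jumpAssumption_of_almost_decreasing hW h_one hG hN hmean hNn
      (one_pos.trans_le hC).ne' hn hn₀
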